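/- **Setting.** Let $(\mathbf X,d)$ be a metric space. It is a *length space* if $d(x,y)$ is, for all $x,y$, the infimum of the lengths of the curves joining $x$ and $y$, and a *geodesic space* if any $x,y$ are joined by a curve of length $d(x,y)$; it is *proper* if its closed bounded subsets are compact. Let $\Omega\subset\mathbf X$ be open and let $\mathrm{Lip}_{loc}(\Omega)$ be the set of locally Lipschitz functions on $\Omega$ (Lipschitz on a small ball around each point). For $u\in \mathrm{Lip}_{loc}(\Omega)$ and $x\in\Omega$ put $$|\nabla u|(x)=\limsup_{y\to x}\frac{|u(y)-u(x)|}{d(x,y)},\qquad |\nabla^-u|(x)=\limsup_{y\to x}\frac{\max\{u(x)-u(y),0\}}{d(x,y)}$$ (both are $0$ at an isolated point), and let $$\underline{\mathcal C}(\Omega)=\{u\in \mathrm{Lip}_{loc}(\Omega): |\nabla^-u|=|\nabla u| \text{ in }\Omega \text{ and } |\nabla u| \text{ is continuous in } \Omega\}.$$ Let $H:\Omega\times\mathbb R\times[0,\infty)\to\mathbb R$ be continuous. A *Monge solution* of $$H(x,u,|\nabla u|)=0\quad\text{in }\Omega \qquad (*)$$ is a function $u\in \mathrm{Lip}_{loc}(\Omega)$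 with $H(x,u(x),|\nabla^-u|(x))=0$ for every $x\in\Omega$. Call $H$ *coercive* if, for every $R>0$, $\inf_{(x,\rho)\in\Omega\times[-R,R]}H(x,\rho,p)\to\infty$ as $p\to\infty$. **Proposition.** Suppose that one of the following holds. (A) $(\mathbf X,d)$ is a complete length space, $H$ is coercive, and for all $x_0\in\Omega$ and $\rho_0\in\mathbb R$: 1. there are $\delta>0$ with $B_\delta(x_0)\subset\Omega$ and a modulus of continuity $\omega$ (that is, $\omega:[0,\infty)\to[0,\infty)$ is continuous at $0$ with $\omega(0)=0$) such that $|H(x_1,\rho_1,p)-H(x_2,\rho_2,p)|\le\omega(d(x_1,x_2)+|\rho_1-\rho_2|)$ for all $x_1,x_2\in B_\delta(x_0)$, $\rho_1,\rho_2\in[\rho_0-\delta,\rho_0+\delta]$ and $p\ge0$; 2. there are $\delta>0$ with $B_\delta(x_0)\subset\Omega$ and $\lambda_0>0$ such that $p\mapsto H(x,\rho,p)-\lambda_0p$ is nondecreasing on $[0,\infty)$ for every $(x,\rho)\in B_\delta(x_0)\times[\rho_0-\delta,\rho_0+\delta]$. (B) $(\mathbf X,d)$ is a complete proper geodesic space,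 $H$ is coercive, and for every $(x,\rho)\in\Omega\times\mathbb R$ the map $p\mapsto H(x,\rho,p)$ is strictly increasing in $(0,\infty)$. If $u$ is a Monge solution of $(*)$, then $|\nabla u|(x)=|\nabla^-u|(x)$ for all $x\in\Omega$, and $u\in\underline{\mathcal C}(\Omega)$. -/

import Mathlib

open Set Filter Topology

noncomputable section

/-- A metric space is a length space if the distance of any two points is the infimum of the
lengths of the curves joining them. A curve is a continuous map from `[0, 1]`, its length is the
supremum of the polygonal sums over all partitions (possibly `∞`). Distances being finite, any two
points are joined by a rectifiable curve, and only rectifiable curves matter in the infimum. -/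
def IsLengthSpace (X : Type*) [MetricSpace X] : Prop :=
  ∀ x y : X, edist x y = ⨅ γ : Path x y, eVariationOn γ univ

/-- A metric space is geodesic if any two points are joined by a curve whose length is their
distance. -/
def IsGeodesicSpace (X : Type*) [MetricSpace X] : Prop :=
  ∀ x y : X, ∃ γ : Path x y, eVariationOn γ univ = edist x y

/-- The local slope `|∇u|(x) = limsup_{y → x} |u(y) - u(x)| / d(x, y)`. For `u` Lipschitz near `x`
the quotient is bounded near `x`, so that the real-valued limsup is the usual one (and it is `0` at
an isolated point). -/
def slopeAt {X : Type*} [MetricSpace X] (u : X → ℝ) (x : X) : ℝ :=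
  limsup (fun y => |u y - u x| / dist x y) (𝓝[≠] x)

/-- The sub-slope `|∇⁻u|(x) = limsup_{y → x} max (u(x) - u(y)) 0 / d(x, y)`. -/
def subSlopeAt {X : Type*} [MetricSpace X] (u : X → ℝ) (x : X) : ℝ :=
  limsup (fun y => max (u x - u y) 0 / dist x y) (𝓝[≠] x)

/-- The test class `C̲(Ω)`: locally Lipschitz functions on `Ω` with `|∇⁻u| = |∇u|` in `Ω` and
`|∇u|` continuous in `Ω`. A function on the open set `Ω` is represented by a function on `X`, whose
values outside `Ω` play no role. -/
def lowerTestClass {X : Type*} [MetricSpace X] (Ω : Set X) : Set (X → ℝ) :=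
  {u | LocallyLipschitzOn Ω u ∧ (∀ x ∈ Ω, subSlopeAt u x = slopeAt u x) ∧
    ContinuousOn (slopeAt u) Ω}

/-- Monge subsolutions of `H(x, u, |∇u|) = 0` in `Ω`. -/
def IsMongeSubsolution {X : Type*} [MetricSpace X] (Ω : Set X) (H : X → ℝ → ℝ → ℝ)
    (u : X → ℝ) : Prop :=
  LocallyLipschitzOn Ω u ∧ ∀ x ∈ Ω, H x (u x) (subSlopeAt u x) ≤ 0

/-- Monge supersolutions of `H(x, u, |∇u|) = 0` in `Ω`. -/
def IsMongeSupersolution {X : Type*} [MetricSpace X] (Ω : Set X) (H : X → ℝ → ℝ → ℝ)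
    (u : X → ℝ) : Prop :=
  LocallyLipschitzOn Ω u ∧ ∀ x ∈ Ω, 0 ≤ H x (u x) (subSlopeAt u x)

/-- Monge solutions of `H(x, u, |∇u|) = 0` in `Ω`. -/
def IsMongeSolution {X : Type*} [MetricSpace X] (Ω : Set X) (H : X → ℝ → ℝ → ℝ)
    (u : X → ℝ) : Prop :=
  IsMongeSubsolution Ω H u ∧ IsMongeSupersolution Ω H u

/-- Continuity of the Hamiltonian on `Ω × ℝ × [0, ∞)`; its values elsewhere play no role. -/
def HamiltonianContinuous {X : Type*} [MetricSpace X] (Ω : Set X) (H : X → ℝ → ℝ → ℝ) : Prop :=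
  ContinuousOn (fun q : X × ℝ × ℝ => H q.1 q.2.1 q.2.2) (Ω ×ˢ (univ : Set ℝ) ×ˢ Ici (0 : ℝ))

/-- A modulus of continuity: a nonnegative function on `[0, ∞)` that vanishes and is continuous at
`0`. (No monotonicity is asked for; this only makes a hypothesis weaker.) -/
def IsModulusOfContinuity (ω : ℝ → ℝ) : Prop :=
  (∀ s, 0 ≤ s → 0 ≤ ω s) ∧ ω 0 = 0 ∧ ContinuousWithinAt ω (Ici 0) 0

/-- Local uniform continuity of `(x, ρ) ↦ H(x, ρ, p)`, uniformly in `p ≥ 0`. -/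
def HamiltonianLocallyUniformlyContinuous {X : Type*} [MetricSpace X] (Ω : Set X)
    (H : X → ℝ → ℝ → ℝ) : Prop :=
  ∀ x₀ ∈ Ω, ∀ ρ₀ : ℝ, ∃ δ > 0, Metric.ball x₀ δ ⊆ Ω ∧ ∃ ω : ℝ → ℝ, IsModulusOfContinuity ω ∧
    ∀ x₁ ∈ Metric.ball x₀ δ, ∀ x₂ ∈ Metric.ball x₀ δ,
    ∀ ρ₁ ∈ Icc (ρ₀ - δ) (ρ₀ + δ), ∀ ρ₂ ∈ Icc (ρ₀ - δ) (ρ₀ + δ), ∀ p : ℝ, 0 ≤ p →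
      |H x₁ ρ₁ p - H x₂ ρ₂ p| ≤ ω (dist x₁ x₂ + |ρ₁ - ρ₂|)

/-- Locally in `(x, ρ)` there is `lam > 0` such that `p ↦ H(x, ρ, p) - lam * p` is nondecreasing
on `[0, ∞)`. -/
def HamiltonianLocallyStronglyIncreasing {X : Type*} [MetricSpace X] (Ω : Set X)
    (H : X → ℝ → ℝ → ℝ) : Prop :=
  ∀ x₀ ∈ Ω, ∀ ρ₀ : ℝ, ∃ δ > 0, Metric.ball x₀ δ ⊆ Ω ∧ ∃ lam > 0,
    ∀ x ∈ Metric.ball x₀ δ, ∀ ρ ∈ Icc (ρ₀ - δ) (ρ₀ + δ),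
      MonotoneOn (fun p => H x ρ p - lam * p) (Ici 0)

/-- Coercivity: for each `R > 0`, the infimum of `H(x, ρ, p)` over `Ω × [-R, R]`, taken in the
extended reals, tends to `∞` as `p → ∞`. -/
def HamiltonianCoercive {X : Type*} (Ω : Set X) (H : X → ℝ → ℝ → ℝ) : Prop :=
  ∀ R : ℝ, 0 < R →
    Tendsto (fun p : ℝ => ⨅ x ∈ Ω, ⨅ ρ ∈ Icc (-R) R, ((H x ρ p : ℝ) : EReal)) atTop (𝓝 ⊤)

/-- The assumptions in a complete length space. -/
def LengthSpaceAssumptions {X : Type*} [MetricSpace X] (Ω : Set X) (H : X → ℝ → ℝ → ℝ) : Prop :=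
  CompleteSpace X ∧ IsLengthSpace X ∧ IsOpen Ω ∧ HamiltonianContinuous Ω H ∧
    HamiltonianLocallyUniformlyContinuous Ω H ∧ HamiltonianLocallyStronglyIncreasing Ω H ∧
    HamiltonianCoercive Ω H

/-- The assumptions in a complete proper geodesic space. -/
def ProperSpaceAssumptions {X : Type*} [MetricSpace X] (Ω : Set X) (H : X → ℝ → ℝ → ℝ) : Prop :=
  CompleteSpace X ∧ ProperSpace X ∧ IsGeodesicSpace X ∧ IsOpen Ω ∧ HamiltonianContinuous Ω H ∧
    HamiltonianCoercive Ω H ∧ ∀ x ∈ Ω, ∀ ρ : ℝ, StrictMonoOn (H x ρ) (Ioi 0)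

end

/-! In both cases `X` is a length space and `H x ρ` is strictly increasing on `[0, ∞)`. Hence
`subSlopeAt u x` is the only nonnegative zero of `H x (u x)`, and the persistence of strict signs of
`H` at fixed `p` makes it continuous in `x` (`HamiltonianContinuous.continuousOn_zero`). If the
sub-slope is below `M` near `x`, then `u` drops by at most `M` times the length along short curves
(`sub_le_mul_length`). Almost shortest curves, run in both directions, give a two-sided Lipschitz
bound `M`, so the slope at `x` is at most `M`; now let `M` decrease to the sub-slope. -/

section Slopes

variable {X : Type*} [MetricSpace X] {u : X → ℝ} {Ω : Set X} {x : X}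

theorem IsGeodesicSpace.isLengthSpace (h : IsGeodesicSpace X) : IsLengthSpace X := by
  intro x y
  refine le_antisymm (le_iInf fun γ => ?_) ?_
  · simpa using eVariationOn.edist_le γ (mem_univ (0 : unitInterval)) (mem_univ 1)
  · obtain ⟨γ, hγ⟩ := h x y
    exact hγ ▸ iInf_le _ γ

theorem LocallyLipschitzOn.exists_eventually_abs_sub_le (hu : LocallyLipschitzOn Ω u)
    (hΩ : IsOpen Ω) (hx : x ∈ Ω) : ∃ K : ℝ, ∀ᶠ y in 𝓝 x, |u y - u x| ≤ K * dist x y := by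
  obtain ⟨K, t, ht, hK⟩ := hu hx
  rw [hΩ.nhdsWithin_eq hx] at ht
  refine ⟨K, ?_⟩
  filter_upwards [ht] with y hy
  have := hK.dist_le_mul y hy x (mem_of_mem_nhds ht)
  rwa [Real.dist_eq, dist_comm y x] at this

theorem max_sub_zero_div_le_abs_div (u : X → ℝ) (x y : X) :
    max (u x - u y) 0 / dist x y ≤ |u y - u x| / dist x y := by
  gcongr
  exact max_le (by rw [abs_sub_comm]; exact le_abs_self _) (abs_nonneg _)

theorem isBoundedUnder_slope (hu : LocallyLipschitzOn Ω u) (hΩ : IsOpen Ω) (hx : x ∈ Ω) :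
    IsBoundedUnder (· ≤ ·) (𝓝[≠] x) (fun y => |u y - u x| / dist x y) := by
  obtain ⟨K, hK⟩ := hu.exists_eventually_abs_sub_le hΩ hx
  refine ⟨K, ?_⟩
  rw [eventually_map]
  filter_upwards [nhdsWithin_le_nhds hK, self_mem_nhdsWithin] with y hy hne
  rwa [div_le_iff₀ (dist_pos.2 (Ne.symm hne))]

theorem isBoundedUnder_subSlope (hu : LocallyLipschitzOn Ω u) (hΩ : IsOpen Ω) (hx : x ∈ Ω) :
    IsBoundedUnder (· ≤ ·) (𝓝[≠] x) (fun y => max (u x - u y) 0 / dist x y) :=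
  (isBoundedUnder_slope hu hΩ hx).mono_le (Eventually.of_forall (max_sub_zero_div_le_abs_div u x))

theorem isCoboundedUnder_of_nonneg {α : Type*} {l : Filter α} [NeBot l] {f : α → ℝ}
    (hf : ∀ a, 0 ≤ f a) : IsCoboundedUnder (· ≤ ·) l f :=
  (isBoundedUnder_of ⟨0, hf⟩ : IsBoundedUnder (· ≥ ·) l f).isCoboundedUnder_le

theorem slopeAt_eq_zero_of_isolated (h : 𝓝[≠] x = ⊥) : slopeAt u x = 0 := by
  -- Along `⊥` the real limsup is `sInf univ`, whose default value is `0`.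
  simp [slopeAt, h, limsup_eq]

theorem subSlopeAt_eq_zero_of_isolated (h : 𝓝[≠] x = ⊥) : subSlopeAt u x = 0 := by
  simp [subSlopeAt, h, limsup_eq]

theorem subSlopeAt_nonneg (hu : LocallyLipschitzOn Ω u) (hΩ : IsOpen Ω) (hx : x ∈ Ω) :
    0 ≤ subSlopeAt u x := by
  rcases eq_or_neBot (𝓝[≠] x) with h | h
  · exact (subSlopeAt_eq_zero_of_isolated h).ge
  · exact le_limsup_of_frequently_le (Frequently.of_forall fun y => by positivity)
      (isBoundedUnder_subSlope hu hΩ hx)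

theorem subSlopeAt_le_slopeAt (hu : LocallyLipschitzOn Ω u) (hΩ : IsOpen Ω) (hx : x ∈ Ω) :
    subSlopeAt u x ≤ slopeAt u x := by
  rcases eq_or_neBot (𝓝[≠] x) with h | h
  · rw [subSlopeAt_eq_zero_of_isolated h, slopeAt_eq_zero_of_isolated h]
  · exact limsup_le_limsup (Eventually.of_forall (max_sub_zero_div_le_abs_div u x))
      (isCoboundedUnder_of_nonneg fun y => by positivity) (isBoundedUnder_slope hu hΩ hx)

theorem slopeAt_le_of_eventually {M : ℝ} (hM : 0 ≤ M)
    (h : ∀ᶠ y in 𝓝 x, |u y - u x| ≤ M * dist x y) : slopeAt u x ≤ M := by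
  rcases eq_or_neBot (𝓝[≠] x) with hb | hb
  · rwa [slopeAt_eq_zero_of_isolated hb]
  · refine limsup_le_of_le (isCoboundedUnder_of_nonneg fun y => by positivity) ?_
    filter_upwards [nhdsWithin_le_nhds h, self_mem_nhdsWithin] with y hy hne
    rwa [div_le_iff₀ (dist_pos.2 (Ne.symm hne))]

theorem eventually_sub_le_of_subSlopeAt_lt {M : ℝ} (hu : LocallyLipschitzOn Ω u) (hΩ : IsOpen Ω)
    (hx : x ∈ Ω) (h : subSlopeAt u x < M) : ∀ᶠ y in 𝓝 x, u x - u y ≤ M * dist x y := by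
  have := eventually_lt_of_limsup_lt h (isBoundedUnder_subSlope hu hΩ hx)
  filter_upwards [eventually_nhdsWithin_iff.1 this] with y hy
  rcases eq_or_ne y x with rfl | hne
  · simp
  · have h' := hy hne
    rw [div_lt_iff₀ (dist_pos.2 hne.symm)] at h'
    exact (le_max_left _ _).trans h'.le

/-! ### Decrease of `u` along curves -/

/-- Along a path of finite length on which the sub-slope of `u` is below `M`, the function `u`
decreases by at most `M` times the length. -/
theorem sub_le_mul_length {M : ℝ} (hM : 0 ≤ M) {x y : X} (γ : Path x y)
    (hγ : eVariationOn γ univ ≠ ⊤) (hc : ∀ t, ContinuousAt u (γ t))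
    (h : ∀ t, ∀ᶠ z in 𝓝 (γ t), u (γ t) - u z ≤ M * dist (γ t) z) :
    u x - u y ≤ M * (eVariationOn γ univ).toReal := by
  set ℓ : unitInterval → ℝ := fun t => (eVariationOn γ (Iic t)).toReal with hℓ
  have hfin : ∀ s, eVariationOn γ s ≠ ⊤ := fun s =>
    ne_top_of_le_ne_top hγ (eVariationOn.mono γ (subset_univ s))
  have hmono : Monotone ℓ := fun s t hst =>
    ENNReal.toReal_mono (hfin _) (eVariationOn.mono γ (Iic_subset_Iic.2 hst))
  have hdist : ∀ s t, s ≤ t → dist (γ s) (γ t) ≤ ℓ t - ℓ s := by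
    intro s t hst
    have h1 : eVariationOn γ (Iic s) + edist (γ s) (γ t) ≤ eVariationOn γ (Iic t) := by
      calc eVariationOn γ (Iic s) + edist (γ s) (γ t)
          ≤ eVariationOn γ (Iic s) + eVariationOn γ (Icc s t) := by
            gcongr
            exact eVariationOn.edist_le γ (left_mem_Icc.2 hst) (right_mem_Icc.2 hst)
        _ ≤ eVariationOn γ (Iic s ∪ Icc s t) :=
            eVariationOn.add_le_union γ fun a ha b hb => le_trans ha hb.1
        _ ≤ eVariationOn γ (Iic t) :=
            eVariationOn.mono γ (union_subset (Iic_subset_Iic.2 hst) fun a ha => ha.2)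
    have h2 := ENNReal.toReal_mono (hfin _) h1
    rw [ENNReal.toReal_add (hfin _) (edist_ne_top _ _), ← dist_edist] at h2
    linarith
  have hcγ : ∀ t, ContinuousAt (fun s => u (γ s)) t := fun t =>
    ContinuousAt.comp (f := γ) (hc t) γ.continuous.continuousAt
  -- Continuous induction: the supremum `c` of the times up to which the estimate holds must be `1`.
  set S : Set unitInterval := {t | ∀ s ≤ t, u x - u (γ s) ≤ M * ℓ s} with hS
  have h0 : (0 : unitInterval) ∈ S := by
    intro s hs
    have : s = 0 := le_antisymm hs s.2.1
    subst this
    simp only [γ.source, sub_self]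
    exact mul_nonneg hM ENNReal.toReal_nonneg
  have hlub := isLUB_sSup S
  set c := sSup S
  have hlt : ∀ s < c, u x - u (γ s) ≤ M * ℓ s := by
    intro s hs
    obtain ⟨t, ht, hst⟩ := (lt_isLUB_iff hlub).1 hs
    exact ht s hst.le
  -- Continuity of `ℓ` is not needed at `c`: times in `S` lie below `c`, so `ℓ t ≤ ℓ c` by
  -- monotonicity.
  have hcS : u x - u (γ c) ≤ M * ℓ c := by
    by_cases hcm : c ∈ S
    · exact hcm c le_rfl
    · have hfr : ∃ᶠ t in 𝓝 c, t ∈ S :=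
        mem_closure_iff_frequently.1 (hlub.mem_closure ⟨0, h0⟩)
      by_contra hcon
      push Not at hcon
      have hev : ∀ᶠ t in 𝓝 c, M * ℓ c < u x - u (γ t) :=
        (continuousAt_const.sub (hcγ c)).eventually_const_lt hcon
      obtain ⟨t, htS, ht⟩ := (hfr.and_eventually hev).exists
      have := htS t le_rfl
      have := mul_le_mul_of_nonneg_left (hmono (hlub.1 htS)) hM
      linarith
  have hc1 : c = 1 := by
    -- If `c < 1`, the local bound at `γ c` carries the estimate past `c`, since distances are at
    -- most increments of `ℓ`.
    by_contra hne
    have hc1 : c < 1 := lt_of_le_of_ne c.2.2 hne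
    have hev := γ.continuous.continuousAt.eventually (h c)
    obtain ⟨d, hd, hIco⟩ := exists_Ico_subset_of_mem_nhds hev ⟨1, hc1⟩
    obtain ⟨e, hce, hed⟩ := exists_between hd
    refine absurd (hlub.1 (show e ∈ S from fun s hs => ?_)) (not_le.2 hce)
    rcases lt_or_ge s c with hsc | hsc
    · exact hlt s hsc
    · have h1 : u (γ c) - u (γ s) ≤ M * dist (γ c) (γ s) := hIco ⟨hsc, hs.trans_lt hed⟩
      have := mul_le_mul_of_nonneg_left (hdist c s hsc) hM
      linarith
  rw [hc1, γ.target] at hcS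
  refine hcS.trans (mul_le_mul_of_nonneg_left ?_ hM)
  exact ENNReal.toReal_mono hγ (eVariationOn.mono γ (subset_univ _))

theorem IsLengthSpace.exists_path_lt (hX : IsLengthSpace X) (x y : X) {L : ℝ} (hL : dist x y < L) :
    ∃ γ : Path x y, eVariationOn γ univ < ENNReal.ofReal L := by
  rw [← iInf_lt_iff, ← hX x y, edist_dist]
  exact (ENNReal.ofReal_lt_ofReal_iff (dist_nonneg.trans_lt hL)).2 hL

/-- In a length space, a bound on the sub-slope in a ball bounds the oscillation of `u`. -/
theorem sub_le_mul_dist_of_subSlopeAt_lt (hX : IsLengthSpace X) (hu : LocallyLipschitzOn Ω u)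
    (hΩ : IsOpen Ω) {M r : ℝ} (hM : 0 ≤ M) (hr : Metric.ball x r ⊆ Ω)
    (h : ∀ y ∈ Metric.ball x r, subSlopeAt u y < M) {y z : X}
    (hy : dist x y + dist y z < r) : u y - u z ≤ M * dist y z := by
  -- A shortest curve may not exist, so take length below `L > dist y z`. The second condition keeps
  -- the curve in the ball.
  have key : ∀ L > dist y z, dist x y + L < r → u y - u z ≤ M * L := by
    intro L hL hLr
    obtain ⟨γ, hγ⟩ := hX.exists_path_lt y z hL
    have hL0 : 0 ≤ L := dist_nonneg.trans hL.le
    have hball : ∀ t, γ t ∈ Metric.ball x r := by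
      intro t
      have h1 : edist y (γ t) < ENNReal.ofReal L := by
        refine lt_of_le_of_lt ?_ hγ
        simpa using eVariationOn.edist_le γ (mem_univ (0 : unitInterval)) (mem_univ t)
      rw [edist_dist, ENNReal.ofReal_lt_ofReal_iff_of_nonneg dist_nonneg] at h1
      rw [Metric.mem_ball, dist_comm]
      linarith [dist_triangle x y (γ t)]
    refine (sub_le_mul_length hM γ hγ.ne_top (fun t => ?_) fun t => ?_).trans
      (mul_le_mul_of_nonneg_left (ENNReal.toReal_le_of_le_ofReal hL0 hγ.le) hM)
    · exact hu.continuousOn.continuousAt (hΩ.mem_nhds (hr (hball t)))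
    · exact eventually_sub_le_of_subSlopeAt_lt hu hΩ (hr (hball t)) (h _ (hball t))
  have ht : Tendsto (fun L => M * L) (𝓝[>] dist y z) (𝓝 (M * dist y z)) :=
    ((continuous_const.mul continuous_id).tendsto _).mono_left nhdsWithin_le_nhds
  refine ge_of_tendsto ht ?_
  have : ∀ᶠ L in 𝓝 (dist y z), dist x y + L < r :=
    (continuous_const.add continuous_id).continuousAt.eventually_lt_const hy
  filter_upwards [self_mem_nhdsWithin, nhdsWithin_le_nhds this] with L h1 h2 using key L h1 h2

theorem slopeAt_eq_subSlopeAt (hX : IsLengthSpace X) (hu : LocallyLipschitzOn Ω u)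
    (hΩ : IsOpen Ω) (hx : x ∈ Ω) (hc : ContinuousAt (subSlopeAt u) x) :
    slopeAt u x = subSlopeAt u x := by
  refine le_antisymm (le_of_forall_gt_imp_ge_of_dense fun M hM => ?_)
    (subSlopeAt_le_slopeAt hu hΩ hx)
  have hM0 : 0 ≤ M := (subSlopeAt_nonneg hu hΩ hx).trans hM.le
  obtain ⟨r, hr, hball⟩ := Metric.eventually_nhds_iff_ball.1
    ((hc.eventually_lt_const hM).and (hΩ.mem_nhds hx))
  refine slopeAt_le_of_eventually hM0 ?_
  -- Half the radius, because the estimate from `y` back to `x` requires `dist x y + dist y x < r`.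
  filter_upwards [Metric.ball_mem_nhds x (half_pos hr)] with y hy
  rw [Metric.mem_ball, dist_comm] at hy
  have hs : Metric.ball x r ⊆ Ω := fun z hz => (hball z hz).2
  have hl : ∀ z ∈ Metric.ball x r, subSlopeAt u z < M := fun z hz => (hball z hz).1
  have h1 := sub_le_mul_dist_of_subSlopeAt_lt hX hu hΩ hM0 hs hl (y := x) (z := y)
    (by rw [dist_self]; linarith)
  have h2 := sub_le_mul_dist_of_subSlopeAt_lt hX hu hΩ hM0 hs hl (y := y) (z := x)
    (by rw [dist_comm y x]; linarith)
  rw [dist_comm y x] at h2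
  exact abs_le.2 ⟨by linarith, h2⟩

end Slopes

/-! ### Zeros of the Hamiltonian in `p` -/

section Hamiltonian

variable {X : Type*} [MetricSpace X] {Ω : Set X} {H : X → ℝ → ℝ → ℝ}

/-- Zeros in `p` of a Hamiltonian strictly increasing in `p` depend continuously on `x`. -/
theorem HamiltonianContinuous.continuousOn_zero (hH : HamiltonianContinuous Ω H)
    (hmono : ∀ x ∈ Ω, ∀ ρ, StrictMonoOn (H x ρ) (Ici 0)) {u f : X → ℝ} (hu : ContinuousOn u Ω)
    (hf : ∀ x ∈ Ω, 0 ≤ f x) (hz : ∀ x ∈ Ω, H x (u x) (f x) = 0) : ContinuousOn f Ω := by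
  have hc : ∀ p, 0 ≤ p → ContinuousOn (fun x => H x (u x) p) Ω := fun p hp =>
    ContinuousOn.comp (f := fun x => (x, u x, p)) hH
      (continuousOn_id.prodMk (hu.prodMk continuousOn_const)) fun x hx => ⟨hx, mem_univ _, hp⟩
  intro x hx
  refine tendsto_order.2 ⟨fun a ha => ?_, fun b hb => ?_⟩
  -- Monotonicity in `p` says nothing below `0`; there `f ≥ 0` suffices.
  · rcases lt_or_ge a 0 with h0 | h0
    · filter_upwards [self_mem_nhdsWithin] with y hy using h0.trans_le (hf y hy)
    · have h1 : H x (u x) a < 0 := hz x hx ▸ hmono x hx (u x) h0 (hf x hx) ha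
      filter_upwards [(hc a h0 x hx).eventually_lt_const h1, self_mem_nhdsWithin] with y hy hyΩ
      rw [← hz y hyΩ] at hy
      exact ((hmono y hyΩ (u y)).lt_iff_lt h0 (hf y hyΩ)).1 hy
  · have h0 : 0 ≤ b := (hf x hx).trans hb.le
    have h1 : 0 < H x (u x) b := by
      simpa only [hz x hx] using hmono x hx (u x) (hf x hx) h0 hb
    filter_upwards [(hc b h0 x hx).eventually_const_lt h1, self_mem_nhdsWithin] with y hy hyΩ
    rw [← hz y hyΩ] at hy
    exact ((hmono y hyΩ (u y)).lt_iff_lt (hf y hyΩ) h0).1 hy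

theorem HamiltonianLocallyStronglyIncreasing.strictMonoOn
    (h : HamiltonianLocallyStronglyIncreasing Ω H) {x : X} (hx : x ∈ Ω) (ρ : ℝ) :
    StrictMonoOn (H x ρ) (Ici 0) := by
  obtain ⟨δ, hδ, -, lam, hlam, hm⟩ := h x hx ρ
  intro p hp q hq hpq
  have h1 := hm x (Metric.mem_ball_self hδ) ρ ⟨by linarith, by linarith⟩ hp hq hpq.le
  have h2 := mul_lt_mul_of_pos_left hpq hlam
  dsimp only at h1
  linarith

theorem HamiltonianContinuous.strictMonoOn_Ici (hH : HamiltonianContinuous Ω H) {x : X}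
    (hx : x ∈ Ω) {ρ : ℝ} (h : StrictMonoOn (H x ρ) (Ioi 0)) : StrictMonoOn (H x ρ) (Ici 0) := by
  have hc : ContinuousOn (H x ρ) (Ici 0) :=
    ContinuousOn.comp (f := fun p : ℝ => (x, ρ, p)) hH
      (by fun_prop) fun p hp => ⟨hx, mem_univ _, hp⟩
  intro p hp q hq hpq
  rcases eq_or_lt_of_le (show (0 : ℝ) ≤ p from hp) with rfl | hp0
  -- Right continuity at `0` gives only a weak inequality; the midpoint `q / 2` restores strictness.
  · have hq2 : 0 < q / 2 := half_pos hpq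
    have hle : H x ρ 0 ≤ H x ρ (q / 2) := by
      have ht : Tendsto (H x ρ) (𝓝[>] 0) (𝓝 (H x ρ 0)) :=
        (hc 0 hp).mono_left (nhdsWithin_mono _ Ioi_subset_Ici_self)
      refine le_of_tendsto ht ?_
      filter_upwards [Ioc_mem_nhdsGT hq2] with s hs
      exact h.monotoneOn hs.1 hq2 hs.2
    exact hle.trans_lt (h hq2 hpq (by linarith))
  · exact h hp0 (hp0.trans hpq) hpq

end Hamiltonian

theorem proposition4p11 {X : Type*} [MetricSpace X] (Ω : Set X) (H : X → ℝ → ℝ → ℝ)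
    (hyp : LengthSpaceAssumptions Ω H ∨ ProperSpaceAssumptions Ω H)
    (u : X → ℝ) (hu : IsMongeSolution Ω H u) :
    (∀ x ∈ Ω, slopeAt u x = subSlopeAt u x) ∧ u ∈ lowerTestClass Ω := by
  obtain ⟨hX, hΩ, hH, hmono⟩ : IsLengthSpace X ∧ IsOpen Ω ∧ HamiltonianContinuous Ω H ∧
      ∀ x ∈ Ω, ∀ ρ, StrictMonoOn (H x ρ) (Ici 0) := by
    rcases hyp with ⟨-, hX, hΩ, hH, -, hm, -⟩ | ⟨-, -, hX, hΩ, hH, -, hm⟩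
    · exact ⟨hX, hΩ, hH, fun x hx ρ => hm.strictMonoOn hx ρ⟩
    · exact ⟨hX.isLengthSpace, hΩ, hH, fun x hx ρ => hH.strictMonoOn_Ici hx (hm x hx ρ)⟩
  have hL : LocallyLipschitzOn Ω u := hu.1.1
  have hc : ContinuousOn (subSlopeAt u) Ω :=
    hH.continuousOn_zero hmono hL.continuousOn (fun x hx => subSlopeAt_nonneg hL hΩ hx)
      fun x hx => le_antisymm (hu.1.2 x hx) (hu.2.2 x hx)
  have heq : ∀ x ∈ Ω, slopeAt u x = subSlopeAt u x := fun x hx =>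
    slopeAt_eq_subSlopeAt hX hL hΩ hx (hc.continuousAt (hΩ.mem_nhds hx))
  exact ⟨heq, hL, fun x hx => (heq x hx).symm, hc.congr heq⟩
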